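/- **Corollary 1.3.** For a Borel probability measure $\mu$ on $\mathbb{R}$ put $U_\mu(x)=\int\log|x-z|\,d\mu(z)$ and $I(\mu)=\iint\log|x_1-x_2|\,d\mu(x_1)\,d\mu(x_2)$, with $\log 0=-\infty$. For a finite set $A\subset\mathbb{R}[x]$ of polynomials with real roots, let $\lambda_A=\inf_\mu\int x\,d\mu(x)$, where $\mu$ ranges over the Borel probability measures supported on $[0,\infty)$ such that $I(\mu)\ge 0$ and $\int\log|Q(x)|\,d\mu(x)\ge 0$ for every $Q\in A$. For $A=\emptyset$ (so that only the constraint $I(\mu)\ge 0$ remains) we have $\lambda_\emptyset=\sqrt e$. Moreover, the infimum is attained by exactly one measure, namely the measure $\mu_\emptyset$ on $[0,4\sqrt e]$ given by $$d\mu_\emptyset=\frac{1}{2\pi}\sqrt{\frac{4\sqrt e-x}{e\,x}}\,dx .$$ This measure is also the only probability measure $\mu$ supported on a finite union $\Sigma\subset[0,18]$ of compact intervals of positive length such that $\int x\,d\mu=\lambda_\emptyset$, $I(\mu)=0$, and, for some $\lambda_0>0$, $x\ge\lambda_\emptyset+\lambda_0U_\mu(x)$ for all $x\ge 0$ with equality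 for all $x\in\Sigma$. -/

import Mathlib

open MeasureTheory
open scoped ENNReal

noncomputable section

namespace TraceProblem

/-- The integral of an extended-real-valued function, as the integral of its positive part minus
the integral of its negative part. It takes the values `+∞` and `-∞` where the integral diverges;
in the indeterminate case `∞ - ∞` it is `-∞`. -/
def eIntegral {X : Type*} [MeasurableSpace X] (μ : Measure X) (f : X → EReal) : EReal :=
  ((∫⁻ x, (f x).toENNReal ∂μ : ℝ≥0∞) : EReal) - ((∫⁻ x, (-(f x)).toENNReal ∂μ : ℝ≥0∞) : EReal)

/-- `log |t|` as an extended real number, with `log |0| = -∞`. -/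
def logAbs (t : ℝ) : EReal := ENNReal.log (ENNReal.ofReal |t|)

/-- The expectation `∫ x dμ(x)`. -/
def expectation (μ : Measure ℝ) : EReal := eIntegral μ (fun x => (x : EReal))

/-- The logarithmic potential `U_μ(x) = ∫ log |x - z| dμ(z)`. -/
def potential (μ : Measure ℝ) (x : ℝ) : EReal := eIntegral μ (fun z => logAbs (x - z))

/-- The logarithmic energy `I(μ) = ∫ log |x₁ - x₂| dμ(x₁) dμ(x₂)`. -/
def logEnergy (μ : Measure ℝ) : EReal :=
  eIntegral (μ.prod μ) (fun p => logAbs (p.1 - p.2))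

/-- The competitors in the optimization problem attached to `A`: Borel probability measures
supported on the non-negative reals with `I(μ) ≥ 0` and `∫ log |Q| dμ ≥ 0` for every `Q ∈ A`. -/
structure IsFeasible (A : Finset (Polynomial ℝ)) (μ : Measure ℝ) : Prop where
  isProbabilityMeasure : IsProbabilityMeasure μ
  nonneg_support : μ (Set.Iio 0) = 0
  energy_nonneg : 0 ≤ logEnergy μ
  log_nonneg : ∀ Q ∈ A, 0 ≤ eIntegral μ (fun x => logAbs (Q.eval x))

/-- `λ_A`, the infimum of `∫ x dμ(x)` over all competitors. -/
def lambdaInf (A : Finset (Polynomial ℝ)) : EReal :=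
  sInf {t | ∃ μ : Measure ℝ, IsFeasible A μ ∧ t = expectation μ}

/-- `μ` is a competitor that attains the infimum `λ_A`. -/
def IsMinimizer (A : Finset (Polynomial ℝ)) (μ : Measure ℝ) : Prop :=
  IsFeasible A μ ∧ expectation μ = lambdaInf A

/-- The list of conditions that characterizes the optimal measure `μ_A`: it is a probability
measure on a finite union `S ⊆ [0, 18]` of intervals, has expectation `λ_A` and energy `0`, and
for some `λ_Q ≥ 0` and `λ_0 > 0` the inequality
`x ≥ λ_A + ∑ λ_Q log |Q(x)| + λ_0 U_μ(x)` holds for all `x ≥ 0`, with equality on `S`, while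
`∫ log |Q| dμ = 0` whenever `λ_Q ≠ 0`. -/
def IsOptimalMeasure (A : Finset (Polynomial ℝ)) (μ : Measure ℝ) : Prop :=
  IsProbabilityMeasure μ ∧
  expectation μ = lambdaInf A ∧
  logEnergy μ = 0 ∧
  ∃ (l : ℕ) (a b : Fin (l + 1) → ℝ) (S : Set ℝ),
    (∀ i, a i < b i) ∧ S = (⋃ i, Set.Icc (a i) (b i)) ∧ S ⊆ Set.Icc 0 18 ∧ μ Sᶜ = 0 ∧
    ∃ (c : Polynomial ℝ → ℝ) (c₀ : ℝ), (∀ Q ∈ A, 0 ≤ c Q) ∧ 0 < c₀ ∧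
      (∀ x : ℝ, 0 ≤ x →
        lambdaInf A + ∑ Q ∈ A, (c Q : EReal) * logAbs (Q.eval x)
          + (c₀ : EReal) * potential μ x ≤ (x : EReal)) ∧
      (∀ x ∈ S,
        lambdaInf A + ∑ Q ∈ A, (c Q : EReal) * logAbs (Q.eval x)
          + (c₀ : EReal) * potential μ x = (x : EReal)) ∧
      (∀ Q ∈ A, c Q ≠ 0 → eIntegral μ (fun x => logAbs (Q.eval x)) = 0)

/-- The measure on `[0, 4√e]` with density `(1 / 2π) √((4√e - x) / (e x))` with respect to
Lebesgue measure. -/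
def schurMeasure : Measure ℝ :=
  (volume.restrict (Set.Icc 0 (4 * √(Real.exp 1)))).withDensity
    (fun x => ENNReal.ofReal
      (1 / (2 * Real.pi) * √((4 * √(Real.exp 1) - x) / (Real.exp 1 * x))))

end TraceProblem

end

/-!
The logarithmic energy `I` is strictly concave along probability measures: for `μ ≠ σ` of finite
energy, `I(μ) - 2 I(μ, σ) + I(σ) < 0`, where `I(μ, σ)` is the mutual energy `∫ U_σ dμ`. Take for
`σ` the measure `schurMeasure`. Its potential satisfies `U_σ(x) ≤ x / (2√e) - 1/2` for all `x ≥ 0`,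
with equality on the support `[0, 4√e]`; since its mean is `√e`, this gives `I(σ) = 0`. A
competitor `μ` of finite mean `m` therefore satisfies
`0 ≤ I(μ) ≤ 2 ∫ U_σ dμ ≤ m / √e - 1`, so `m ≥ √e`, and `m = √e` forces equality in the concavity
inequality, that is `μ = σ` (`sqrt_exp_one_le_integral`). The optimality conditions hold for `σ`
with `λ_0 = 2√e`, and every measure that satisfies them is a competitor that attains the infimum.

Concavity (`LogEnergy.energy_sub`) comes from two integral representations with elementary kernels,
`-log d = ∫_0^∞ (exp (-t d) - exp (-t)) / t dt` and
`exp (-t |x - y|) = 2 t ∫ 1_{u ≤ x} exp (-t (x - u)) 1_{u ≤ y} exp (-t (y - u)) du`. Together they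
write `-I(μ - σ)` as an integral of squares of differences of one-sided exponential transforms, and
one such transform determines a measure on the half-line.

For the potential, the substitution `x = 2√e (1 + cos φ)` turns `σ` into `(1 - cos φ) dφ / π` on
`(0, π)` (`schurMeasure_eq_map`). The identity
`2 cos ψ - 2 cos φ = 2 sin ((φ + ψ) / 2) * 2 sin ((φ - ψ) / 2)` unfolds the integral to the whole
circle, where only the integrals of `log |2 sin (α / 2)|` and of `cos α * log |2 sin (α / 2)|` are
needed. Beyond the edge `4√e` the tangent line at the edge bounds the potential.
-/

open Set Filter Topology

/-! ### Concavity of the logarithmic energy -/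

namespace LogEnergy

lemma integrableOn_exp_sub_exp_div {a b : ℝ} (ha : 0 < a) (hab : a ≤ b) :
    IntegrableOn (fun t : ℝ => t⁻¹ • (Real.exp (-(a * t)) - Real.exp (-(b * t)))) (Ioi 0) := by
  have h1 : IntegrableOn (fun t : ℝ => (b - a) * Real.exp (-a * t)) (Ioi 0) :=
    (exp_neg_integrableOn_Ioi 0 ha).const_mul _
  refine Integrable.mono' h1 (by fun_prop) ?_
  filter_upwards [ae_restrict_mem measurableSet_Ioi] with t ht
  have ht : (0 : ℝ) < t := ht
  have hle : Real.exp (-(b * t)) ≤ Real.exp (-(a * t)) :=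
    Real.exp_le_exp.2 (by nlinarith)
  rw [smul_eq_mul, Real.norm_of_nonneg (mul_nonneg (inv_nonneg.2 ht.le) (by linarith))]
  have h2 : Real.exp (-(b * t)) = Real.exp (-(a * t)) * Real.exp (-((b - a) * t)) := by
    rw [← Real.exp_add]; ring_nf
  have h3 := Real.add_one_le_exp (-((b - a) * t))
  have h4 := Real.exp_pos (-(a * t))
  rw [inv_mul_le_iff₀ ht, h2, neg_mul]
  nlinarith

lemma integral_exp_sub_exp_div {a b : ℝ} (ha : 0 < a) (hab : a ≤ b) :
    ∫ t in Ioi (0 : ℝ), t⁻¹ • (Real.exp (-(a * t)) - Real.exp (-(b * t))) = Real.log (b / a) := by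
  have hc : Continuous (fun t : ℝ => Real.exp (-t)) := by fun_prop
  have hL : Tendsto (fun t : ℝ => Real.exp (-t)) (𝓝[>] 0) (𝓝 1) := by
    have := hc.tendsto 0
    simp only [neg_zero, Real.exp_zero] at this
    exact this.mono_left nhdsWithin_le_nhds
  have hR : Tendsto (fun t : ℝ => Real.exp (-t)) atTop (𝓝 0) :=
    Real.tendsto_exp_neg_atTop_nhds_zero
  have := Frullani.integral_Ioi_eq (hc.locallyIntegrable.locallyIntegrableOn _) ha
    (ha.trans_le hab) hL hR (integrableOn_exp_sub_exp_div ha hab)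
  simpa using this

/-- The integrand of the representation
`-log d = ∫ t in (0, ∞), (exp (-(d * t)) - exp (-t)) / t`. -/
noncomputable def frullaniKernel (d t : ℝ) : ℝ := t⁻¹ * (Real.exp (-(d * t)) - Real.exp (-t))

/-- The kernel has constant sign in `t`, so that the integral of its norm is `|log d|`. -/
lemma frullaniKernel_spec {d : ℝ} (hd : 0 < d) :
    IntegrableOn (frullaniKernel d) (Ioi 0) ∧
      ∫ t in Ioi (0 : ℝ), frullaniKernel d t = -Real.log d ∧
      ∫ t in Ioi (0 : ℝ), ‖frullaniKernel d t‖ = |Real.log d| := by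
  rcases le_total d 1 with h | h
  · have e : frullaniKernel d = fun t : ℝ => t⁻¹ • (Real.exp (-(d * t)) - Real.exp (-(1 * t))) := by
      funext t; simp [frullaniKernel]
    have hi : ∫ t in Ioi (0 : ℝ), frullaniKernel d t = -Real.log d := by
      rw [e, integral_exp_sub_exp_div hd h]; simp
    refine ⟨e ▸ integrableOn_exp_sub_exp_div hd h, hi, ?_⟩
    rw [abs_of_nonpos (Real.log_nonpos hd.le h), ← hi]
    refine setIntegral_congr_fun measurableSet_Ioi fun t ht => ?_
    have ht : (0 : ℝ) < t := ht
    refine Real.norm_of_nonneg (mul_nonneg (inv_nonneg.2 ht.le) (sub_nonneg.2 ?_))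
    exact Real.exp_le_exp.2 (by nlinarith)
  · have e : frullaniKernel d =
        fun t : ℝ => -(t⁻¹ • (Real.exp (-(1 * t)) - Real.exp (-(d * t)))) := by
      funext t; simp only [frullaniKernel, smul_eq_mul, one_mul]; ring
    have hi : ∫ t in Ioi (0 : ℝ), frullaniKernel d t = -Real.log d := by
      rw [e, integral_neg, integral_exp_sub_exp_div one_pos h]; simp
    refine ⟨e ▸ (integrableOn_exp_sub_exp_div one_pos h).neg, hi, ?_⟩
    rw [abs_of_nonneg (Real.log_nonneg h), ← neg_neg (Real.log d), ← hi, ← integral_neg]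
    refine setIntegral_congr_fun measurableSet_Ioi fun t ht => ?_
    have ht : (0 : ℝ) < t := ht
    refine Real.norm_of_nonpos (mul_nonpos_of_nonneg_of_nonpos (inv_nonneg.2 ht.le)
      (sub_nonpos.2 ?_))
    exact Real.exp_le_exp.2 (by nlinarith)

variable {μ σ : Measure ℝ}

/-- The mutual energy `∬ exp (-t |x - y|) dμ(x) dσ(y)` of the exponential kernel. -/
noncomputable def expEnergy (μ σ : Measure ℝ) (t : ℝ) : ℝ :=
  ∫ p : ℝ × ℝ, Real.exp (-(|p.1 - p.2| * t)) ∂(μ.prod σ)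

/-- The one-sided exponential transform `∫_{x ≥ u} exp (-t (x - u)) dμ(x)`. -/
noncomputable def expTail (μ : Measure ℝ) (t u : ℝ) : ℝ :=
  ∫ x, (Ici u).indicator (fun x => Real.exp (-(t * (x - u)))) x ∂μ

lemma integrable_exp_abs [IsFiniteMeasure μ] [IsFiniteMeasure σ] {t : ℝ} (ht : 0 ≤ t) :
    Integrable (fun p : ℝ × ℝ => Real.exp (-(|p.1 - p.2| * t))) (μ.prod σ) := by
  refine Integrable.mono' (integrable_const 1) (by fun_prop) (Eventually.of_forall fun p => ?_)
  rw [Real.norm_of_nonneg (Real.exp_pos _).le, Real.exp_le_one_iff]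
  have := mul_nonneg (abs_nonneg (p.1 - p.2)) ht
  linarith

/-- The mutual logarithmic energy as an integral of exponential energies. -/
lemma integral_frullaniKernel_prod [IsProbabilityMeasure μ] [IsProbabilityMeasure σ]
    (hd : ∀ᵐ p ∂(μ.prod σ), p.1 ≠ p.2)
    (hi : Integrable (fun p : ℝ × ℝ => Real.log |p.1 - p.2|) (μ.prod σ)) :
    IntegrableOn (fun t => t⁻¹ * (expEnergy μ σ t - Real.exp (-t))) (Ioi 0) ∧
      ∫ t in Ioi (0 : ℝ), t⁻¹ * (expEnergy μ σ t - Real.exp (-t)) =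
        -∫ p : ℝ × ℝ, Real.log |p.1 - p.2| ∂(μ.prod σ) := by
  have hpos : ∀ᵐ p ∂(μ.prod σ), 0 < |p.1 - p.2| := by
    filter_upwards [hd] with p hp using abs_pos.2 (sub_ne_zero.2 hp)
  have hmeas : Measurable (fun q : (ℝ × ℝ) × ℝ => frullaniKernel |q.1.1 - q.1.2| q.2) := by
    unfold frullaniKernel; fun_prop
  have hint : Integrable (fun q : (ℝ × ℝ) × ℝ => frullaniKernel |q.1.1 - q.1.2| q.2)
      ((μ.prod σ).prod (volume.restrict (Ioi 0))) := by
    rw [integrable_prod_iff hmeas.aestronglyMeasurable]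
    refine ⟨hpos.mono fun p hp => (frullaniKernel_spec hp).1, hi.abs.congr ?_⟩
    exact hpos.mono fun p hp => ((frullaniKernel_spec hp).2.2).symm
  have hinner : ∀ t ∈ Ioi (0 : ℝ), ∫ p : ℝ × ℝ, frullaniKernel |p.1 - p.2| t ∂(μ.prod σ) =
      t⁻¹ * (expEnergy μ σ t - Real.exp (-t)) := by
    intro t ht
    have ht : (0 : ℝ) < t := ht
    simp only [frullaniKernel]
    rw [integral_const_mul, integral_sub (integrable_exp_abs ht.le) (integrable_const _)]
    simp [expEnergy]
  constructor
  · refine Integrable.congr hint.integral_prod_right ?_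
    filter_upwards [ae_restrict_mem measurableSet_Ioi] with t ht using hinner t ht
  · rw [← setIntegral_congr_fun measurableSet_Ioi hinner]
    have hswap := integral_integral_swap (μ := μ.prod σ) (ν := volume.restrict (Ioi (0 : ℝ)))
      (f := fun p t => frullaniKernel |p.1 - p.2| t) hint
    rw [← hswap, ← integral_neg]
    exact integral_congr_ae (hpos.mono fun p hp => (frullaniKernel_spec hp).2.1)

lemma integral_indicator_mul_indicator {t : ℝ} (ht : 0 < t) (x y : ℝ) :
    Integrable (fun u => (Ici u).indicator (fun x => Real.exp (-(t * (x - u)))) x *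
      (Ici u).indicator (fun y => Real.exp (-(t * (y - u)))) y) ∧
    ∫ u, (Ici u).indicator (fun x => Real.exp (-(t * (x - u)))) x *
      (Ici u).indicator (fun y => Real.exp (-(t * (y - u)))) y =
        (2 * t)⁻¹ * Real.exp (-(|x - y| * t)) := by
  have e : (fun u => (Ici u).indicator (fun x => Real.exp (-(t * (x - u)))) x *
      (Ici u).indicator (fun y => Real.exp (-(t * (y - u)))) y) =
      (Iic (min x y)).indicator
        (fun u => Real.exp (-(t * (x + y))) * Real.exp ((2 * t) * u)) := by
    funext u
    by_cases hx : u ≤ x <;> by_cases hy : u ≤ y <;>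
      simp only [indicator, mem_Ici, mem_Iic, le_min_iff, hx, hy, and_true, and_false,
        if_true, if_false, zero_mul, mul_zero]
    rw [← Real.exp_add, ← Real.exp_add]; ring_nf
  have ht2 : 0 < 2 * t := by linarith
  rw [e]
  refine ⟨(integrable_indicator_iff measurableSet_Iic).2
    ((integrableOn_exp_mul_Iic ht2 _).const_mul _), ?_⟩
  rw [integral_indicator measurableSet_Iic, integral_const_mul, integral_exp_mul_Iic ht2,
    ← mul_div_assoc, ← Real.exp_add, div_eq_inv_mul]
  congr 2
  rcases le_total x y with h | h
  · rw [min_eq_left h, abs_of_nonpos (by linarith)]; ring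
  · rw [min_eq_right h, abs_of_nonneg (by linarith)]; ring

/-- The exponential kernel factors through one-sided exponentials, which makes it
positive definite. -/
lemma expEnergy_eq [IsFiniteMeasure μ] [IsFiniteMeasure σ] {t : ℝ} (ht : 0 < t) :
    Integrable (fun u => expTail μ t u * expTail σ t u) ∧
      ∫ u, expTail μ t u * expTail σ t u = (2 * t)⁻¹ * expEnergy μ σ t := by
  set k : ℝ → ℝ → ℝ := fun u x => (Ici u).indicator (fun x => Real.exp (-(t * (x - u)))) x with hk
  have hkm : Measurable (fun q : ℝ × ℝ => k q.1 q.2) := by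
    have : (fun q : ℝ × ℝ => k q.1 q.2) =
        {q : ℝ × ℝ | q.1 ≤ q.2}.indicator (fun q => Real.exp (-(t * (q.2 - q.1)))) := by
      funext q; simp [hk, indicator]
    rw [this]
    exact Measurable.indicator (by fun_prop) (measurableSet_le measurable_fst measurable_snd)
  have hk0 : ∀ u x, 0 ≤ k u x := fun u x => indicator_nonneg (fun _ _ => (Real.exp_pos _).le) _
  have hmeas : Measurable (fun q : (ℝ × ℝ) × ℝ => k q.2 q.1.1 * k q.2 q.1.2) :=
    (hkm.comp (measurable_snd.prodMk (measurable_fst.comp measurable_fst))).mul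
      (hkm.comp (measurable_snd.prodMk (measurable_snd.comp measurable_fst)))
  have hint : Integrable (fun q : (ℝ × ℝ) × ℝ => k q.2 q.1.1 * k q.2 q.1.2)
      ((μ.prod σ).prod volume) := by
    rw [integrable_prod_iff hmeas.aestronglyMeasurable]
    refine ⟨Eventually.of_forall fun p => (integral_indicator_mul_indicator ht p.1 p.2).1, ?_⟩
    refine ((integrable_exp_abs ht.le).const_mul (2 * t)⁻¹).congr (Eventually.of_forall fun p => ?_)
    simp only
    rw [← (integral_indicator_mul_indicator ht p.1 p.2).2]
    exact integral_congr_ae (Eventually.of_forall fun u =>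
      (Real.norm_of_nonneg (mul_nonneg (hk0 _ _) (hk0 _ _))).symm)
  have hinner : ∀ u, ∫ p : ℝ × ℝ, k u p.1 * k u p.2 ∂(μ.prod σ) =
      expTail μ t u * expTail σ t u := fun u => integral_prod_mul _ _
  constructor
  · exact hint.integral_prod_right.congr (Eventually.of_forall hinner)
  · simp_rw [← hinner]
    have hswap := integral_integral_swap (μ := μ.prod σ) (ν := (volume : Measure ℝ))
      (f := fun p u => k u p.1 * k u p.2) hint
    rw [← hswap, expEnergy, ← integral_const_mul]
    exact integral_congr_ae (Eventually.of_forall fun p =>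
      (integral_indicator_mul_indicator ht p.1 p.2).2)

/-- The exponential energy of `μ - σ` is a multiple of an integral of squares. -/
lemma expEnergy_sub_sq [IsFiniteMeasure μ] [IsFiniteMeasure σ] {t : ℝ} (ht : 0 < t) :
    Integrable (fun u => (expTail μ t u - expTail σ t u) ^ 2) ∧
      expEnergy μ μ t - 2 * expEnergy μ σ t + expEnergy σ σ t =
        2 * t * ∫ u, (expTail μ t u - expTail σ t u) ^ 2 := by
  obtain ⟨i1, e1⟩ := expEnergy_eq (μ := μ) (σ := μ) ht
  obtain ⟨i2, e2⟩ := expEnergy_eq (μ := μ) (σ := σ) ht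
  obtain ⟨i3, e3⟩ := expEnergy_eq (μ := σ) (σ := σ) ht
  have e : (fun u => (expTail μ t u - expTail σ t u) ^ 2) = fun u =>
      (expTail μ t u * expTail μ t u - 2 * (expTail μ t u * expTail σ t u)) +
        expTail σ t u * expTail σ t u := by
    funext u; ring
  have i12 : Integrable (fun u => expTail μ t u * expTail μ t u -
      2 * (expTail μ t u * expTail σ t u)) := i1.sub (i2.const_mul 2)
  rw [e]
  refine ⟨i12.add i3, ?_⟩
  rw [integral_add i12 i3, integral_sub i1 (i2.const_mul 2),
    integral_const_mul, e1, e2, e3]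
  field_simp

/-- A finite measure on the half-line is determined by almost all values of one of its
one-sided exponential transforms. -/
lemma eq_of_expTail_ae_eq [IsFiniteMeasure μ] [IsFiniteMeasure σ] (hμ : μ (Iio 0) = 0)
    (hσ : σ (Iio 0) = 0) {t : ℝ} (ht : 0 < t) (h : expTail μ t =ᵐ[volume] expTail σ t) :
    μ = σ := by
  set f : ℝ → ℝ≥0∞ := fun x => ENNReal.ofReal (Real.exp (-(t * x))) with hf
  have hfm : Measurable f := by fun_prop
  have hfin : ∀ ρ : Measure ℝ, IsFiniteMeasure ρ → ρ (Iio 0) = 0 →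
      IsFiniteMeasure (ρ.withDensity f) := by
    intro ρ _ h0
    refine isFiniteMeasure_withDensity (ne_top_of_le_ne_top (measure_ne_top ρ univ) ?_)
    rw [← lintegral_one]
    refine lintegral_mono_ae ?_
    have : ∀ᵐ x ∂ρ, x ∉ Iio (0 : ℝ) := measure_eq_zero_iff_ae_notMem.1 h0
    filter_upwards [this] with x hx
    have hx : 0 ≤ x := not_lt.1 hx
    rw [hf, ENNReal.ofReal_le_one, Real.exp_le_one_iff]
    have := mul_nonneg ht.le hx
    linarith
  have hfinμ := hfin μ inferInstance hμ
  have hfinσ := hfin σ inferInstance hσ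
  -- Up to the factor `exp (t u)`, the transform is the tail of the measure `exp (-t x) dρ(x)`,
  -- which is finite because `ρ` lives on the half-line.
  have htail : ∀ ρ : Measure ℝ, ∀ u, expTail ρ t u =
      Real.exp (t * u) * ((ρ.withDensity f) (Ici u)).toReal := by
    intro ρ u
    rw [expTail, integral_indicator measurableSet_Ici, withDensity_apply _ measurableSet_Ici,
      ← integral_toReal hfm.aemeasurable (Eventually.of_forall fun x => ENNReal.ofReal_lt_top),
      ← integral_const_mul]
    refine integral_congr_ae (Eventually.of_forall fun x => ?_)
    simp only [hf]
    rw [ENNReal.toReal_ofReal (Real.exp_pos _).le, ← Real.exp_add]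
    ring_nf
  have hae : ∀ᵐ u : ℝ, (μ.withDensity f) (Ici u) = (σ.withDensity f) (Ici u) := by
    filter_upwards [h] with u hu
    rw [htail, htail] at hu
    exact (ENNReal.toReal_eq_toReal_iff' (measure_ne_top _ _) (measure_ne_top _ _)).1
      (mul_left_cancel₀ (Real.exp_pos _).ne' hu)
  have hD : Dense {u : ℝ | (μ.withDensity f) (Ici u) = (σ.withDensity f) (Ici u)} :=
    Measure.dense_of_ae hae
  have heq : μ.withDensity f = σ.withDensity f := by
    refine Measure.ext_of_Ici _ _ fun a => ?_
    -- Approach `a` from the left, so that the half-lines `[u n, ∞)` decrease to `[a, ∞)`.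
    obtain ⟨u, hu, hlt, hlim⟩ := hD.exists_seq_strictMono_tendsto a
    have hI : Ici a = ⋂ n, Ici (u n) := by
      ext x
      simp only [mem_Ici, mem_iInter]
      exact ⟨fun hx n => ((hlt n).1.le).trans hx,
        fun hx => le_of_tendsto hlim (Eventually.of_forall hx)⟩
    have hanti : Antitone fun n => Ici (u n) := fun m n hmn => Ici_subset_Ici.2 (hu.monotone hmn)
    rw [hI]
    refine tendsto_nhds_unique
      (tendsto_measure_iInter_atTop (fun n => measurableSet_Ici.nullMeasurableSet) hanti
        ⟨0, measure_ne_top _ _⟩) ?_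
    have := tendsto_measure_iInter_atTop (μ := σ.withDensity f)
      (fun n => measurableSet_Ici.nullMeasurableSet) hanti ⟨0, measure_ne_top _ _⟩
    exact this.congr fun n => ((hlt n).2).symm
  have h1 := withDensity_inv_same (μ := μ) hfm (Eventually.of_forall fun x => by
    simp [hf, Real.exp_pos]) (Eventually.of_forall fun x => by simp [hf])
  have h2 := withDensity_inv_same (μ := σ) hfm (Eventually.of_forall fun x => by
    simp [hf, Real.exp_pos]) (Eventually.of_forall fun x => by simp [hf])
  rw [← h1, heq, h2]

/-- Strict concavity of the logarithmic energy: the energy of the difference of two distinct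
probability measures is negative. -/
theorem energy_sub [IsProbabilityMeasure μ] [IsProbabilityMeasure σ]
    (hμ : μ (Iio 0) = 0) (hσ : σ (Iio 0) = 0)
    (dμμ : ∀ᵐ p ∂(μ.prod μ), p.1 ≠ p.2) (dμσ : ∀ᵐ p ∂(μ.prod σ), p.1 ≠ p.2)
    (dσσ : ∀ᵐ p ∂(σ.prod σ), p.1 ≠ p.2)
    (iμμ : Integrable (fun p : ℝ × ℝ => Real.log |p.1 - p.2|) (μ.prod μ))
    (iμσ : Integrable (fun p : ℝ × ℝ => Real.log |p.1 - p.2|) (μ.prod σ))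
    (iσσ : Integrable (fun p : ℝ × ℝ => Real.log |p.1 - p.2|) (σ.prod σ)) :
    let E : ℝ := (∫ p : ℝ × ℝ, Real.log |p.1 - p.2| ∂(μ.prod μ)) -
      2 * (∫ p : ℝ × ℝ, Real.log |p.1 - p.2| ∂(μ.prod σ)) +
      ∫ p : ℝ × ℝ, Real.log |p.1 - p.2| ∂(σ.prod σ)
    E ≤ 0 ∧ (E = 0 → μ = σ) := by
  intro E
  obtain ⟨i1, e1⟩ := integral_frullaniKernel_prod dμμ iμμ
  obtain ⟨i2, e2⟩ := integral_frullaniKernel_prod dμσ iμσ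
  obtain ⟨i3, e3⟩ := integral_frullaniKernel_prod dσσ iσσ
  -- The terms `exp (-t)` cancel since the difference `μ - σ` has total mass zero.
  have hcongr : ∀ t ∈ Ioi (0 : ℝ),
      (t⁻¹ * (expEnergy μ μ t - Real.exp (-t)) - 2 * (t⁻¹ * (expEnergy μ σ t - Real.exp (-t)))) +
        t⁻¹ * (expEnergy σ σ t - Real.exp (-t)) =
      2 * ∫ u, (expTail μ t u - expTail σ t u) ^ 2 := by
    intro t ht
    have ht : (0 : ℝ) < t := ht
    have := (expEnergy_sub_sq (μ := μ) (σ := σ) ht).2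
    field_simp
    linarith
  have i12 : IntegrableOn (fun t => t⁻¹ * (expEnergy μ μ t - Real.exp (-t)) -
      2 * (t⁻¹ * (expEnergy μ σ t - Real.exp (-t)))) (Ioi 0) := i1.sub (i2.const_mul 2)
  have hI := (i12.add i3).congr
    (show _ =ᵐ[volume.restrict (Ioi 0)] _ from
      (ae_restrict_mem measurableSet_Ioi).mono hcongr)
  have hE : -E = ∫ t in Ioi (0 : ℝ), 2 * ∫ u, (expTail μ t u - expTail σ t u) ^ 2 := by
    rw [← setIntegral_congr_fun measurableSet_Ioi hcongr,
      integral_add i12 i3, integral_sub i1 (i2.const_mul 2),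
      integral_const_mul, e1, e2, e3]
    ring
  have hnn : ∀ t, 0 ≤ 2 * ∫ u, (expTail μ t u - expTail σ t u) ^ 2 := fun t =>
    mul_nonneg zero_le_two (integral_nonneg fun u => sq_nonneg _)
  refine ⟨?_, fun h0 => ?_⟩
  · have := integral_nonneg (μ := volume.restrict (Ioi (0 : ℝ))) (show 0 ≤ fun t =>
      2 * ∫ u, (expTail μ t u - expTail σ t u) ^ 2 from hnn)
    linarith
  · rw [h0, neg_zero, eq_comm, integral_eq_zero_iff_of_nonneg hnn hI] at hE
    have : ∃ᵐ t ∂(volume.restrict (Ioi (0 : ℝ))), t ∈ Ioi (0 : ℝ) := by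
      have : (ae (volume.restrict (Ioi (0 : ℝ)))).NeBot := by
        rw [ae_neBot]; simp
      exact (ae_restrict_mem measurableSet_Ioi).frequently
    obtain ⟨t, ht, ht0⟩ := (this.and_eventually hE).exists
    have hsq := (expEnergy_sub_sq (μ := μ) (σ := σ) ht).1
    have hz : ∫ u, (expTail μ t u - expTail σ t u) ^ 2 = 0 := by
      simpa using ht0
    rw [integral_eq_zero_iff_of_nonneg (fun u => sq_nonneg _) hsq] at hz
    refine eq_of_expTail_ae_eq hμ hσ ht (hz.mono fun u hu => ?_)
    exact sub_eq_zero.1 (pow_eq_zero_iff two_ne_zero |>.1 hu)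

end LogEnergy

/-! ### Logarithmic integrals on the circle -/

namespace ChordLog

/-- The logarithm of the length `|1 - exp (i α)| = |2 sin (α / 2)|` of a chord of the unit circle.
The absolute value is built into `Real.log`. -/
noncomputable def chordLog (α : ℝ) : ℝ := Real.log (2 * Real.sin (α / 2))

lemma chordLog_neg (α : ℝ) : chordLog (-α) = chordLog α := by
  rw [chordLog, chordLog, neg_div, Real.sin_neg, mul_neg, Real.log_neg_eq_log]

lemma chordLog_periodic : Function.Periodic chordLog (2 * Real.pi) := by
  intro α
  rw [chordLog, chordLog, show (α + 2 * Real.pi) / 2 = α / 2 + Real.pi by ring, Real.sin_add_pi,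
    mul_neg, Real.log_neg_eq_log]

lemma intervalIntegrable_chordLog (a b : ℝ) : IntervalIntegrable chordLog volume a b := by
  have h : MeromorphicOn (fun α : ℝ => 2 * Real.sin (α / 2)) (uIcc a b) := by
    apply AnalyticOnNhd.meromorphicOn
    intro x _
    fun_prop
  have := h.intervalIntegrable_log_norm
  simp only [Real.norm_eq_abs, Real.log_abs] at this
  exact this

lemma intervalIntegrable_mul_chordLog {f : ℝ → ℝ} (hf : Continuous f) (a b : ℝ) :
    IntervalIntegrable (fun α => f α * chordLog α) volume a b :=
  (intervalIntegrable_chordLog a b).continuousOn_mul hf.continuousOn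

lemma integral_neg_pi_pi_of_even {f : ℝ → ℝ} (hf : ∀ x, f (-x) = f x)
    (hi : IntervalIntegrable f volume 0 Real.pi) :
    ∫ x in (-Real.pi)..Real.pi, f x = 2 * ∫ x in 0..Real.pi, f x := by
  have h1 : IntervalIntegrable f volume (-Real.pi) 0 := by
    have := (IntervalIntegrable.iff_comp_neg (f := f)).1 hi
    simp only [hf, neg_zero] at this
    exact this.symm
  have h2 : ∫ x in (-Real.pi)..0, f x = ∫ x in 0..Real.pi, f x := by
    have := intervalIntegral.integral_comp_neg (a := 0) (b := Real.pi) f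
    simp only [hf, neg_zero] at this
    exact this.symm
  rw [← intervalIntegral.integral_add_adjacent_intervals h1 hi, h2, two_mul]

lemma integral_chordLog_zero_pi : ∫ α in 0..Real.pi, chordLog α = 0 := by
  have h1 : ∫ α in 0..Real.pi, chordLog α =
      2 * ∫ β in 0..(Real.pi / 2), Real.log (2 * Real.sin β) := by
    have := intervalIntegral.integral_comp_div (a := 0) (b := Real.pi)
      (fun β => Real.log (2 * Real.sin β)) (two_ne_zero)
    simpa [chordLog] using this
  have h2 : ∫ β in 0..(Real.pi / 2), Real.log (2 * Real.sin β) =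
      ∫ β in 0..(Real.pi / 2), (Real.log 2 + Real.log (Real.sin β)) := by
    refine intervalIntegral.integral_congr_ae (Eventually.of_forall fun β hβ => ?_)
    rw [uIoc_of_le (by positivity)] at hβ
    rw [Real.log_mul two_ne_zero]
    exact (Real.sin_pos_of_pos_of_lt_pi hβ.1 (by linarith [hβ.2, Real.pi_pos])).ne'
  have h3 : IntervalIntegrable (fun β => Real.log (Real.sin β)) volume 0 (Real.pi / 2) :=
    intervalIntegrable_log_sin
  rw [h1, h2, intervalIntegral.integral_add intervalIntegrable_const h3,
    integral_log_sin_zero_pi_div_two, intervalIntegral.integral_const]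
  simp only [smul_eq_mul]
  ring

/-- Integration by parts: the primitive `sin α * chordLog α - (α + sin α) / 2` of
`cos α * chordLog α` is continuous up to the singularity at `0`. -/
lemma integral_cos_mul_chordLog_zero_pi :
    ∫ α in 0..Real.pi, Real.cos α * chordLog α = -(Real.pi / 2) := by
  have hcont : Continuous (fun α => Real.sin α * chordLog α - (α + Real.sin α) / 2) := by
    have e : (fun α => Real.sin α * chordLog α) = fun α =>
        Real.cos (α / 2) * ((2 * Real.sin (α / 2)) * Real.log (2 * Real.sin (α / 2))) := by
      funext α
      have : Real.sin α = 2 * Real.sin (α / 2) * Real.cos (α / 2) := by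
        rw [← Real.sin_two_mul]; ring_nf
      rw [chordLog, this]; ring
    have h1 : Continuous (fun α => Real.sin α * chordLog α) := by
      rw [e]
      exact (by fun_prop : Continuous fun α : ℝ => Real.cos (α / 2)).mul
        (Real.continuous_mul_log.comp (by fun_prop : Continuous fun α : ℝ => 2 * Real.sin (α / 2)))
    exact h1.sub (by fun_prop)
  have hderiv : ∀ α ∈ Ioo 0 Real.pi,
      HasDerivAt (fun α => Real.sin α * chordLog α - (α + Real.sin α) / 2)
        (Real.cos α * chordLog α) α := by
    intro α hα
    have hs : 0 < Real.sin (α / 2) :=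
      Real.sin_pos_of_pos_of_lt_pi (by linarith [hα.1]) (by linarith [hα.1, hα.2])
    have hd : HasDerivAt (fun α : ℝ => 2 * Real.sin (α / 2))
        (2 * (Real.cos (α / 2) * (1 / 2))) α :=
      (((hasDerivAt_id α).div_const 2).sin).const_mul 2
    have hlog : HasDerivAt chordLog (2 * (Real.cos (α / 2) * (1 / 2)) / (2 * Real.sin (α / 2))) α :=
      hd.log (by positivity)
    have := ((Real.hasDerivAt_sin α).mul hlog).sub
      (((hasDerivAt_id α).add (Real.hasDerivAt_sin α)).div_const 2)
    refine this.congr_deriv ?_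
    have e1 : Real.sin α = 2 * Real.sin (α / 2) * Real.cos (α / 2) := by
      rw [← Real.sin_two_mul]; ring_nf
    have e2 : Real.cos α = 2 * Real.cos (α / 2) ^ 2 - 1 := by
      rw [← Real.cos_two_mul]; ring_nf
    rw [e1, e2]
    field_simp
    ring
  rw [intervalIntegral.integral_eq_sub_of_hasDerivAt_of_le Real.pi_pos.le hcont.continuousOn hderiv
    (intervalIntegrable_mul_chordLog Real.continuous_cos _ _)]
  simp

/-- The potential of `(1 - cos φ) dφ` on a circle. -/
lemma integral_one_sub_cos_mul_chordLog (ψ : ℝ) :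
    ∫ φ in (-Real.pi)..Real.pi, (1 - Real.cos φ) * chordLog (φ - ψ) = Real.pi * Real.cos ψ := by
  have hper : Function.Periodic (fun α => (1 - Real.cos (α + ψ)) * chordLog α) (2 * Real.pi) := by
    intro α
    simp only
    rw [chordLog_periodic, show α + 2 * Real.pi + ψ = α + ψ + 2 * Real.pi by ring,
      Real.cos_add_two_pi]
  have h1 : ∫ φ in (-Real.pi)..Real.pi, (1 - Real.cos φ) * chordLog (φ - ψ) =
      ∫ α in (-Real.pi)..Real.pi, (1 - Real.cos (α + ψ)) * chordLog α := by
    have := intervalIntegral.integral_comp_sub_right (a := -Real.pi) (b := Real.pi)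
      (fun α => (1 - Real.cos (α + ψ)) * chordLog α) ψ
    simp only [sub_add_cancel] at this
    rw [this]
    have := hper.intervalIntegral_add_eq (-Real.pi - ψ) (-Real.pi)
    convert this using 2 <;> ring
  have h0 := intervalIntegrable_chordLog (-Real.pi) Real.pi
  have hc := intervalIntegrable_mul_chordLog Real.continuous_cos (-Real.pi) Real.pi
  have hs := intervalIntegrable_mul_chordLog Real.continuous_sin (-Real.pi) Real.pi
  have hsin : ∫ α in (-Real.pi)..Real.pi, Real.sin α * chordLog α = 0 := by
    have := intervalIntegral.integral_comp_neg (a := -Real.pi) (b := Real.pi)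
      (fun α => Real.sin α * chordLog α)
    simp only [Real.sin_neg, chordLog_neg, neg_neg, neg_mul,
      intervalIntegral.integral_neg] at this
    linarith
  rw [h1]
  have e : ∀ α, (1 - Real.cos (α + ψ)) * chordLog α =
      (chordLog α - Real.cos ψ * (Real.cos α * chordLog α)) +
        Real.sin ψ * (Real.sin α * chordLog α) := by
    intro α; rw [Real.cos_add]; ring
  simp_rw [e]
  rw [intervalIntegral.integral_add (h0.sub (hc.const_mul _)) (hs.const_mul _),
    intervalIntegral.integral_sub h0 (hc.const_mul _), intervalIntegral.integral_const_mul,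
    intervalIntegral.integral_const_mul, hsin,
    integral_neg_pi_pi_of_even chordLog_neg (intervalIntegrable_chordLog _ _),
    integral_neg_pi_pi_of_even (fun x => by rw [Real.cos_neg, chordLog_neg])
      (intervalIntegrable_mul_chordLog Real.continuous_cos _ _),
    integral_chordLog_zero_pi, integral_cos_mul_chordLog_zero_pi]
  ring

lemma log_abs_two_cos_sub_two_cos {φ ψ : ℝ} (h : Real.cos ψ ≠ Real.cos φ) :
    Real.log |2 * Real.cos ψ - 2 * Real.cos φ| = chordLog (φ + ψ) + chordLog (φ - ψ) := by
  have e : 2 * Real.cos ψ - 2 * Real.cos φ =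
      (2 * Real.sin ((φ + ψ) / 2)) * (2 * Real.sin ((φ - ψ) / 2)) := by
    have := Real.cos_sub_cos ψ φ
    rw [← mul_sub, this, add_comm ψ φ, show (ψ - φ) / 2 = -((φ - ψ) / 2) by ring, Real.sin_neg]
    ring
  have hne : 2 * Real.cos ψ - 2 * Real.cos φ ≠ 0 := by
    rw [← mul_sub]; exact mul_ne_zero two_ne_zero (sub_ne_zero.2 h)
  rw [e] at hne
  rw [Real.log_abs, e, Real.log_mul (left_ne_zero_of_mul hne) (right_ne_zero_of_mul hne)]
  rfl

lemma intervalIntegrable_chordLog_shift (ψ a b : ℝ) :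
    IntervalIntegrable (fun φ => (1 - Real.cos φ) * chordLog (φ + ψ)) volume a b := by
  have h := (intervalIntegrable_chordLog (a + ψ) (b + ψ)).comp_add_right ψ
  simp only [add_sub_cancel_right] at h
  exact h.continuousOn_mul (by fun_prop : Continuous fun φ => 1 - Real.cos φ).continuousOn

/-- Folding the circle onto a diameter: the potential of `(1 - cos φ) dφ` at `2 cos ψ`. -/
lemma integral_zero_pi_chordLog_add (ψ : ℝ) :
    ∫ φ in 0..Real.pi, (1 - Real.cos φ) * (chordLog (φ + ψ) + chordLog (φ - ψ)) =
      Real.pi * Real.cos ψ := by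
  have hp : ∀ a b, IntervalIntegrable (fun φ => (1 - Real.cos φ) * chordLog (φ + ψ)) volume a b :=
    intervalIntegrable_chordLog_shift ψ
  have hm : ∀ a b, IntervalIntegrable (fun φ => (1 - Real.cos φ) * chordLog (φ - ψ)) volume a b :=
    intervalIntegrable_chordLog_shift (-ψ)
  have hfold : ∫ φ in 0..Real.pi, (1 - Real.cos φ) * chordLog (φ + ψ) =
      ∫ φ in (-Real.pi)..0, (1 - Real.cos φ) * chordLog (φ - ψ) := by
    have := intervalIntegral.integral_comp_neg (a := 0) (b := Real.pi)
      (fun φ => (1 - Real.cos φ) * chordLog (φ - ψ))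
    rw [neg_zero] at this
    rw [← this]
    refine intervalIntegral.integral_congr fun φ _ => ?_
    rw [Real.cos_neg, ← chordLog_neg (φ + ψ)]
    ring_nf
  simp_rw [mul_add]
  rw [intervalIntegral.integral_add (hp _ _) (hm _ _), hfold,
    intervalIntegral.integral_add_adjacent_intervals (hm _ _) (hm _ _),
    integral_one_sub_cos_mul_chordLog]

end ChordLog

/-! ### The measure `schurMeasure` and its potential -/

namespace TraceProblem

open ChordLog

lemma sqrt_exp_one_pos : 0 < √(Real.exp 1) := Real.sqrt_pos.2 (Real.exp_pos 1)

/-- The measure on the half-circle of angles `(0, π)` with density `(1 - cos φ) / π`. -/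
noncomputable def angleMeasure : Measure ℝ :=
  (volume.restrict (Ioo 0 Real.pi)).withDensity
    (fun φ => ENNReal.ofReal ((1 - Real.cos φ) / Real.pi))

/-- The parametrization `φ ↦ 2√e (1 + cos φ)` of `(0, 4√e)` by angles in `(0, π)`. -/
noncomputable def anglePoint (φ : ℝ) : ℝ := 2 * √(Real.exp 1) + 2 * √(Real.exp 1) * Real.cos φ

lemma measurable_anglePoint : Measurable anglePoint := by
  unfold anglePoint; fun_prop

lemma hasDerivAt_anglePoint (φ : ℝ) :
    HasDerivAt anglePoint (-(2 * √(Real.exp 1) * Real.sin φ)) φ := by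
  have := ((Real.hasDerivAt_cos φ).const_mul (2 * √(Real.exp 1))).const_add (2 * √(Real.exp 1))
  exact this.congr_deriv (by ring)

lemma injOn_anglePoint : InjOn anglePoint (Ioo 0 Real.pi) := by
  intro x hx y hy h
  refine Real.injOn_cos (Ioo_subset_Icc_self hx) (Ioo_subset_Icc_self hy) ?_
  have h2 : 2 * √(Real.exp 1) ≠ 0 := by have := sqrt_exp_one_pos; positivity
  exact mul_left_cancel₀ h2 (add_left_cancel h)

lemma exists_anglePoint_eq {x : ℝ} (h0 : 0 ≤ x) (h4 : x ≤ 4 * √(Real.exp 1)) :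
    ∃ ψ ∈ Icc 0 Real.pi, anglePoint ψ = x := by
  have hL := sqrt_exp_one_pos
  refine ⟨Real.arccos (x / (2 * √(Real.exp 1)) - 1),
    ⟨Real.arccos_nonneg _, Real.arccos_le_pi _⟩, ?_⟩
  rw [anglePoint, Real.cos_arccos]
  · field_simp; ring
  · have : 0 ≤ x / (2 * √(Real.exp 1)) := by positivity
    linarith
  · have : x / (2 * √(Real.exp 1)) ≤ 2 := by rw [div_le_iff₀ (by positivity)]; linarith
    linarith

lemma anglePoint_mem_Ioo {φ : ℝ} (hφ : φ ∈ Ioo 0 Real.pi) :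
    anglePoint φ ∈ Ioo 0 (4 * √(Real.exp 1)) := by
  have hL := sqrt_exp_one_pos
  have h1 : Real.cos φ < 1 := by
    rw [← Real.cos_zero]
    exact Real.cos_lt_cos_of_nonneg_of_le_pi le_rfl hφ.2.le hφ.1
  have h2 : -1 < Real.cos φ := by
    rw [← Real.cos_pi]
    exact Real.cos_lt_cos_of_nonneg_of_le_pi hφ.1.le le_rfl hφ.2
  constructor <;> unfold anglePoint <;> nlinarith

lemma image_anglePoint : anglePoint '' Ioo 0 Real.pi = Ioo 0 (4 * √(Real.exp 1)) := by
  refine Subset.antisymm (image_subset_iff.2 fun φ hφ => anglePoint_mem_Ioo hφ) fun x hx => ?_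
  obtain ⟨ψ, hψ, rfl⟩ := exists_anglePoint_eq hx.1.le hx.2.le
  refine ⟨ψ, ⟨lt_of_le_of_ne hψ.1 ?_, lt_of_le_of_ne hψ.2 ?_⟩, rfl⟩
  · rintro rfl
    have := hx.2
    simp only [anglePoint, Real.cos_zero] at this
    linarith
  · rintro rfl
    have := hx.1
    simp only [anglePoint, Real.cos_pi] at this
    linarith

/-- The Jacobian times the density of `schurMeasure`; the square root is that of
`((1 - cos φ) / (√e sin φ)) ^ 2`. -/
lemma schur_density_anglePoint {φ : ℝ} (hφ : φ ∈ Ioo 0 Real.pi) :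
    |(-(2 * √(Real.exp 1) * Real.sin φ))| * (1 / (2 * Real.pi) *
      √((4 * √(Real.exp 1) - anglePoint φ) / (Real.exp 1 * anglePoint φ))) =
      (1 - Real.cos φ) / Real.pi := by
  have hL := sqrt_exp_one_pos
  have hs := Real.sin_pos_of_pos_of_lt_pi hφ.1 hφ.2
  have hp := (anglePoint_mem_Ioo hφ).1
  have h1 := Real.cos_le_one φ
  have hsq : Real.exp 1 = √(Real.exp 1) ^ 2 := (Real.sq_sqrt (Real.exp_pos 1).le).symm
  have hc : 0 < 1 + Real.cos φ := by
    unfold anglePoint at hp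
    by_contra h
    nlinarith
  have e : (4 * √(Real.exp 1) - anglePoint φ) / (Real.exp 1 * anglePoint φ) =
      ((1 - Real.cos φ) / (√(Real.exp 1) * Real.sin φ)) ^ 2 := by
    rw [div_pow, mul_pow, ← hsq, div_eq_div_iff (by positivity) (by positivity), Real.sin_sq]
    unfold anglePoint
    ring
  rw [e, Real.sqrt_sq (div_nonneg (by linarith) (by positivity)), abs_neg,
    abs_of_pos (by positivity)]
  field_simp

/-- In the angle variable `x = 2√e (1 + cos φ)` the measure `schurMeasure` has density
`(1 - cos φ) / π`. -/
theorem schurMeasure_eq_map : schurMeasure = angleMeasure.map anglePoint := by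
  ext s hs
  rw [Measure.map_apply measurable_anglePoint hs, schurMeasure, angleMeasure,
    withDensity_apply _ hs, withDensity_apply _ (measurable_anglePoint hs),
    ← lintegral_indicator hs, ← lintegral_indicator (measurable_anglePoint hs),
    Measure.restrict_congr_set Ioo_ae_eq_Icc.symm, ← image_anglePoint,
    lintegral_image_eq_lintegral_abs_deriv_mul measurableSet_Ioo
      (fun φ _ => (hasDerivAt_anglePoint φ).hasDerivWithinAt) injOn_anglePoint]
  refine setLIntegral_congr_fun measurableSet_Ioo fun φ hφ => ?_
  by_cases h : anglePoint φ ∈ s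
  · simp only [indicator_of_mem h, indicator_of_mem (show φ ∈ anglePoint ⁻¹' s from h)]
    rw [← ENNReal.ofReal_mul (abs_nonneg _), schur_density_anglePoint hφ]
  · simp only [indicator_of_notMem h, indicator_of_notMem (show φ ∉ anglePoint ⁻¹' s from h),
      mul_zero]

lemma one_sub_cos_div_pi_nonneg (φ : ℝ) : 0 ≤ (1 - Real.cos φ) / Real.pi :=
  div_nonneg (by linarith [Real.cos_le_one φ]) Real.pi_pos.le

lemma integrable_schurMeasure_iff {g : ℝ → ℝ} (hg : Measurable g) :
    Integrable g schurMeasure ↔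
      IntervalIntegrable (fun φ => (1 - Real.cos φ) / Real.pi * g (anglePoint φ)) volume
        0 Real.pi := by
  rw [schurMeasure_eq_map, integrable_map_measure hg.aestronglyMeasurable
    measurable_anglePoint.aemeasurable, angleMeasure,
    integrable_withDensity_iff_integrable_smul' (by fun_prop)
      (Eventually.of_forall fun _ => ENNReal.ofReal_lt_top),
    intervalIntegrable_iff_integrableOn_Ioo_of_le Real.pi_pos.le]
  simp only [ENNReal.toReal_ofReal (one_sub_cos_div_pi_nonneg _), smul_eq_mul, Function.comp_apply]
  rfl

lemma integral_schurMeasure {g : ℝ → ℝ} (hg : Measurable g) :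
    ∫ x, g x ∂schurMeasure =
      ∫ φ in 0..Real.pi, (1 - Real.cos φ) / Real.pi * g (anglePoint φ) := by
  rw [schurMeasure_eq_map, integral_map measurable_anglePoint.aemeasurable
    hg.aestronglyMeasurable, angleMeasure,
    integral_withDensity_eq_integral_toReal_smul (by fun_prop)
      (Eventually.of_forall fun _ => ENNReal.ofReal_lt_top),
    intervalIntegral.integral_of_le Real.pi_pos.le, integral_Ioc_eq_integral_Ioo]
  simp only [ENNReal.toReal_ofReal (one_sub_cos_div_pi_nonneg _), smul_eq_mul]

instance isProbabilityMeasure_schurMeasure : IsProbabilityMeasure schurMeasure := by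
  have h1 : ∫ φ in 0..Real.pi, (1 - Real.cos φ) / Real.pi = 1 := by
    rw [intervalIntegral.integral_div, intervalIntegral.integral_sub intervalIntegrable_const
      (Real.continuous_cos.intervalIntegrable _ _), integral_cos]
    simp [Real.pi_ne_zero]
  have hfin : Integrable (fun _ : ℝ => (1 : ℝ)) schurMeasure := by
    rw [integrable_schurMeasure_iff measurable_const]
    exact Continuous.intervalIntegrable (by fun_prop) _ _
  have : IsFiniteMeasure schurMeasure := by
    rcases integrable_const_iff.1 hfin with h | h
    · exact absurd h one_ne_zero
    · exact h
  have h2 := integral_schurMeasure (g := fun _ => (1 : ℝ)) measurable_const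
  simp only [integral_const, smul_eq_mul, mul_one, h1] at h2
  exact ⟨(ENNReal.toReal_eq_one_iff _).1 h2⟩

lemma schurMeasure_absolutelyContinuous : schurMeasure ≪ volume :=
  (withDensity_absolutelyContinuous _ _).trans Measure.absolutelyContinuous_restrict

instance nullSingletonClass_schurMeasure : NullSingletonClass schurMeasure :=
  ⟨fun x => schurMeasure_absolutelyContinuous (measure_singleton x)⟩

lemma ae_mem_Icc_schurMeasure : ∀ᵐ x ∂schurMeasure, x ∈ Icc 0 (4 * √(Real.exp 1)) :=
  (withDensity_absolutelyContinuous _ _).ae_le (ae_restrict_mem measurableSet_Icc)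

lemma ae_mem_Ico_schurMeasure : ∀ᵐ x ∂schurMeasure, x ∈ Ico 0 (4 * √(Real.exp 1)) := by
  have h : ∀ᵐ x ∂schurMeasure, x ≠ 4 * √(Real.exp 1) :=
    measure_eq_zero_iff_ae_notMem.1 (measure_singleton (4 * √(Real.exp 1)))
  filter_upwards [ae_mem_Icc_schurMeasure, h] with x hx hne
  exact ⟨hx.1, lt_of_le_of_ne hx.2 hne⟩

lemma schurMeasure_compl_Icc : schurMeasure (Icc 0 (4 * √(Real.exp 1)))ᶜ = 0 :=
  ae_mem_Icc_schurMeasure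

lemma schurMeasure_Iio_zero : schurMeasure (Iio 0) = 0 :=
  by
  refine measure_mono_null ?_ schurMeasure_compl_Icc
  intro x (hx : x < 0) h
  exact not_lt.2 h.1 hx

lemma integrable_id_schurMeasure : Integrable (fun x : ℝ => x) schurMeasure := by
  rw [integrable_schurMeasure_iff measurable_id']
  exact Continuous.intervalIntegrable (by unfold anglePoint; fun_prop) _ _

lemma integral_id_schurMeasure : ∫ x, x ∂schurMeasure = √(Real.exp 1) := by
  rw [integral_schurMeasure measurable_id']
  have e : ∀ φ, (1 - Real.cos φ) / Real.pi * anglePoint φ =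
      2 * √(Real.exp 1) / Real.pi * Real.sin φ ^ 2 := by
    intro φ; rw [Real.sin_sq, anglePoint]; ring
  simp_rw [e]
  rw [intervalIntegral.integral_const_mul, integral_sin_sq]
  simp only [Real.sin_zero, Real.sin_pi]
  field_simp
  simp

lemma measurable_log_abs_sub (x : ℝ) : Measurable fun z : ℝ => Real.log |x - z| := by fun_prop

/-- On the support, the potential of `schurMeasure` is affine. -/
lemma schur_potential_of_le {x : ℝ} (h0 : 0 ≤ x) (h4 : x ≤ 4 * √(Real.exp 1)) :
    Integrable (fun z => Real.log |x - z|) schurMeasure ∧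
      ∫ z, Real.log |x - z| ∂schurMeasure = x / (2 * √(Real.exp 1)) - 1 / 2 := by
  have hL := sqrt_exp_one_pos
  obtain ⟨ψ, hψ, rfl⟩ := exists_anglePoint_eq h0 h4
  have key : ∀ᵐ φ, φ ∈ uIoc 0 Real.pi →
      (1 - Real.cos φ) / Real.pi * (1 / 2) +
        Real.pi⁻¹ * ((1 - Real.cos φ) * (chordLog (φ + ψ) + chordLog (φ - ψ))) =
      (1 - Real.cos φ) / Real.pi * Real.log |anglePoint ψ - anglePoint φ| := by
    -- At `φ = ψ` the convention `Real.log 0 = 0` breaks the identity of logarithms.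
    have hne : ∀ᵐ φ : ℝ, φ ≠ ψ := measure_eq_zero_iff_ae_notMem.1 (measure_singleton ψ)
    filter_upwards [hne] with φ hφ hmem
    rw [uIoc_of_le Real.pi_pos.le] at hmem
    have hcos : Real.cos ψ ≠ Real.cos φ := fun h =>
      hφ (Real.injOn_cos hψ (Ioc_subset_Icc_self hmem) h).symm
    have e : anglePoint ψ - anglePoint φ =
        √(Real.exp 1) * (2 * Real.cos ψ - 2 * Real.cos φ) := by unfold anglePoint; ring
    have hne : 2 * Real.cos ψ - 2 * Real.cos φ ≠ 0 := by
      rw [← mul_sub]; exact mul_ne_zero two_ne_zero (sub_ne_zero.2 hcos)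
    -- The scale `√e` contributes `log √e = 1 / 2`.
    rw [e, abs_mul, abs_of_pos hL, Real.log_mul hL.ne' (abs_ne_zero.2 hne),
      log_abs_two_cos_sub_two_cos hcos, Real.log_sqrt (Real.exp_pos 1).le, Real.log_exp]
    ring
  have key' := (ae_restrict_iff' measurableSet_uIoc).2 key
  have i1 : IntervalIntegrable (fun φ => (1 - Real.cos φ) / Real.pi * (1 / 2)) volume
      0 Real.pi := Continuous.intervalIntegrable (by fun_prop) _ _
  have i2 : IntervalIntegrable (fun φ => Real.pi⁻¹ * ((1 - Real.cos φ) *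
      (chordLog (φ + ψ) + chordLog (φ - ψ)))) volume 0 Real.pi := by
    simp_rw [mul_add (1 - Real.cos _)]
    exact ((intervalIntegrable_chordLog_shift ψ _ _).add
      (intervalIntegrable_chordLog_shift (-ψ) _ _)).const_mul _
  constructor
  · rw [integrable_schurMeasure_iff (measurable_log_abs_sub _)]
    exact (i1.add i2).congr_ae key'
  · have h1 := integral_schurMeasure (g := fun _ => (1 / 2 : ℝ)) measurable_const
    rw [integral_schurMeasure (measurable_log_abs_sub _),
      ← intervalIntegral.integral_congr_ae key, intervalIntegral.integral_add i1 i2, ← h1,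
      intervalIntegral.integral_const_mul, integral_zero_pi_chordLog_add]
    simp only [integral_const, probReal_univ, smul_eq_mul, one_mul]
    unfold anglePoint
    field_simp
    ring

/-- The slope at the edge `4√e` of the potential: the density `(1 - cos φ) / π` cancels the
pole. -/
lemma integral_inv_edge_sub_schurMeasure :
    Integrable (fun z => (4 * √(Real.exp 1) - z)⁻¹) schurMeasure ∧
      ∫ z, (4 * √(Real.exp 1) - z)⁻¹ ∂schurMeasure = 1 / (2 * √(Real.exp 1)) := by
  have hL := sqrt_exp_one_pos
  have hm : Measurable fun z : ℝ => (4 * √(Real.exp 1) - z)⁻¹ := by fun_prop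
  have key : ∀ φ ∈ uIoc 0 Real.pi, 1 / (2 * √(Real.exp 1) * Real.pi) =
      (1 - Real.cos φ) / Real.pi * (4 * √(Real.exp 1) - anglePoint φ)⁻¹ := by
    intro φ hφ
    rw [uIoc_of_le Real.pi_pos.le] at hφ
    have h1 : Real.cos φ < 1 := by
      rw [← Real.cos_zero]
      exact Real.cos_lt_cos_of_nonneg_of_le_pi le_rfl hφ.2 hφ.1
    have e : 4 * √(Real.exp 1) - anglePoint φ = 2 * √(Real.exp 1) * (1 - Real.cos φ) := by
      unfold anglePoint; ring
    have : 1 - Real.cos φ ≠ 0 := by linarith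
    rw [e]
    field_simp
  rw [integrable_schurMeasure_iff hm, integral_schurMeasure hm]
  constructor
  · exact intervalIntegrable_const.congr key
  · rw [← intervalIntegral.integral_congr_ae (Eventually.of_forall key),
      intervalIntegral.integral_const]
    simp only [smul_eq_mul]
    field_simp
    ring

/-- Beyond the right edge `4√e` of the support, the potential lies below its tangent at the edge
because the logarithm is concave. -/
lemma schur_potential_of_ge {x : ℝ} (h4 : 4 * √(Real.exp 1) ≤ x) :
    Integrable (fun z => Real.log |x - z|) schurMeasure ∧
      3 / 2 ≤ ∫ z, Real.log |x - z| ∂schurMeasure ∧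
      ∫ z, Real.log |x - z| ∂schurMeasure ≤ x / (2 * √(Real.exp 1)) - 1 / 2 := by
  have hL := sqrt_exp_one_pos
  set R := 4 * √(Real.exp 1) with hR
  obtain ⟨i1, e1⟩ := schur_potential_of_le (x := R) (by positivity) le_rfl
  obtain ⟨i2, e2⟩ := integral_inv_edge_sub_schurMeasure
  have i3 : Integrable (fun z => Real.log |R - z| + (x - R) * (R - z)⁻¹) schurMeasure :=
    i1.add (i2.const_mul _)
  have hlow : ∀ᵐ z ∂schurMeasure, Real.log |R - z| ≤ Real.log |x - z| := by
    filter_upwards [ae_mem_Ico_schurMeasure] with z hz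
    have hz' : 0 < R - z := sub_pos.2 hz.2
    rw [abs_of_pos hz', abs_of_pos (by linarith)]
    exact Real.log_le_log hz' (by linarith)
  have hupp : ∀ᵐ z ∂schurMeasure, Real.log |x - z| ≤ Real.log |R - z| + (x - R) * (R - z)⁻¹ := by
    filter_upwards [ae_mem_Ico_schurMeasure] with z hz
    have hz' : 0 < R - z := sub_pos.2 hz.2
    have hx' : 0 < x - z := by linarith
    rw [abs_of_pos hz', abs_of_pos hx']
    have h := Real.log_le_sub_one_of_pos (div_pos hx' hz')
    rw [Real.log_div hx'.ne' hz'.ne'] at h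
    have e : (x - z) / (R - z) - 1 = (x - R) * (R - z)⁻¹ := by field_simp; ring
    linarith
  have i0 : Integrable (fun z => Real.log |x - z|) schurMeasure :=
    integrable_of_le_of_le (measurable_log_abs_sub x).aestronglyMeasurable hlow hupp i1 i3
  refine ⟨i0, ?_, ?_⟩
  · have := integral_mono_ae i1 i0 hlow
    rw [e1, hR] at this
    refine le_trans (le_of_eq ?_) this
    field_simp
    norm_num
  · have := integral_mono_ae i0 i3 hupp
    rw [integral_add i1 (i2.const_mul _), integral_const_mul, e1, e2] at this
    refine this.trans (le_of_eq ?_)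
    field_simp
    ring

lemma integrable_log_abs_sub_schurMeasure {x : ℝ} (h0 : 0 ≤ x) :
    Integrable (fun z => Real.log |x - z|) schurMeasure := by
  rcases le_total x (4 * √(Real.exp 1)) with h | h
  · exact (schur_potential_of_le h0 h).1
  · exact (schur_potential_of_ge h).1

lemma schur_potential_le {x : ℝ} (h0 : 0 ≤ x) :
    ∫ z, Real.log |x - z| ∂schurMeasure ≤ x / (2 * √(Real.exp 1)) - 1 / 2 := by
  rcases le_total x (4 * √(Real.exp 1)) with h | h
  · exact (schur_potential_of_le h0 h).2.le
  · exact (schur_potential_of_ge h).2.2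

lemma neg_half_le_schur_potential {x : ℝ} (h0 : 0 ≤ x) :
    -(1 / 2) ≤ ∫ z, Real.log |x - z| ∂schurMeasure := by
  have hL := sqrt_exp_one_pos
  rcases le_total x (4 * √(Real.exp 1)) with h | h
  · rw [(schur_potential_of_le h0 h).2]
    have : 0 ≤ x / (2 * √(Real.exp 1)) := by positivity
    linarith
  · linarith [(schur_potential_of_ge h).2.1]

end TraceProblem

/-! ### Energies as absolutely convergent integrals, and optimality -/

namespace TraceProblem

lemma eIntegral_eq_coe_integral {X : Type*} [MeasurableSpace X] {μ : Measure X} {f : X → EReal}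
    {g : X → ℝ} (hfg : ∀ᵐ x ∂μ, f x = (g x : EReal)) (hg : Integrable g μ) :
    eIntegral μ f = ((∫ x, g x ∂μ : ℝ) : EReal) := by
  have h1 : ∫⁻ x, (f x).toENNReal ∂μ = ∫⁻ x, ENNReal.ofReal (g x) ∂μ :=
    lintegral_congr_ae (hfg.mono fun x hx => by
      simp only [hx, EReal.real_coe_toENNReal])
  have h2 : ∫⁻ x, (-(f x)).toENNReal ∂μ = ∫⁻ x, ENNReal.ofReal (-(g x)) ∂μ :=
    lintegral_congr_ae (hfg.mono fun x hx => by
      simp only [hx, ← EReal.coe_neg, EReal.real_coe_toENNReal])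
  have f1 : ∫⁻ x, ENNReal.ofReal (g x) ∂μ ≠ ⊤ := hg.lintegral_lt_top.ne
  have f2 : ∫⁻ x, ENNReal.ofReal (-(g x)) ∂μ ≠ ⊤ := hg.neg.lintegral_lt_top.ne
  rw [eIntegral, h1, h2, integral_eq_lintegral_pos_part_sub_lintegral_neg_part hg, EReal.coe_sub,
    EReal.coe_ennreal_toReal f1, EReal.coe_ennreal_toReal f2]

lemma logAbs_zero : logAbs 0 = ⊥ := by simp [logAbs]

lemma logAbs_of_ne_zero {t : ℝ} (ht : t ≠ 0) : logAbs t = (Real.log |t| : EReal) :=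
  ENNReal.log_ofReal_of_pos (abs_pos.2 ht)

lemma ae_prod_ne_of_nullSingleton (μ σ : Measure ℝ) [SFinite μ] [SFinite σ]
    [NullSingletonClass σ] : ∀ᵐ p ∂(μ.prod σ), p.1 ≠ p.2 := by
  have hm : MeasurableSet {p : ℝ × ℝ | p.1 ≠ p.2} :=
    (measurableSet_eq_fun measurable_fst measurable_snd).compl
  refine (Measure.ae_prod_mem_iff_ae_ae_mem hm).2 (Eventually.of_forall fun x => ?_)
  have : ∀ᵐ y ∂σ, y ∉ ({x} : Set ℝ) := measure_eq_zero_iff_ae_notMem.1 (measure_singleton x)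
  exact this.mono fun y hy h => hy (Eq.symm h)

lemma measurable_logAbs_sub : Measurable fun p : ℝ × ℝ => logAbs (p.1 - p.2) :=
  ENNReal.measurable_log.comp (by fun_prop)

lemma log_abs_sub_le {x y : ℝ} (hx : 0 ≤ x) (hy : 0 ≤ y) : Real.log |x - y| ≤ x + y :=
  (Real.log_le_self (abs_nonneg _)).trans (abs_le.2 ⟨by linarith, by linarith⟩)

lemma ae_nonneg_of_Iio_zero {μ : Measure ℝ} (h : μ (Iio 0) = 0) : ∀ᵐ x ∂μ, 0 ≤ x :=
  (measure_eq_zero_iff_ae_notMem.1 h).mono fun _ hx => not_lt.1 hx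

variable {μ : Measure ℝ}

/-- For a probability measure of finite mean and nonnegative energy, the product measure does not
charge the diagonal, and the energy is an absolutely convergent integral. -/
lemma integrable_log_of_logEnergy_nonneg [IsProbabilityMeasure μ] (h0 : μ (Iio 0) = 0)
    (hi : Integrable (fun x : ℝ => x) μ) (hE : 0 ≤ logEnergy μ) :
    (∀ᵐ p ∂(μ.prod μ), p.1 ≠ p.2) ∧
      Integrable (fun p : ℝ × ℝ => Real.log |p.1 - p.2|) (μ.prod μ) := by
  have hnn := ae_nonneg_of_Iio_zero h0
  have hsum : Integrable (fun p : ℝ × ℝ => p.1 + p.2) (μ.prod μ) :=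
    (hi.comp_fst μ).add (hi.comp_snd μ)
  have hle : ∀ᵐ p ∂(μ.prod μ), Real.log |p.1 - p.2| ≤ p.1 + p.2 := by
    filter_upwards [Measure.quasiMeasurePreserving_fst.ae hnn,
      Measure.quasiMeasurePreserving_snd.ae hnn] with p h1 h2 using log_abs_sub_le h1 h2
  have hpos : ∫⁻ p : ℝ × ℝ, (logAbs (p.1 - p.2)).toENNReal ∂(μ.prod μ) ≠ ⊤ := by
    refine ne_top_of_le_ne_top hsum.lintegral_lt_top.ne (lintegral_mono_ae (hle.mono fun p hp => ?_))
    by_cases h : p.1 - p.2 = 0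
    · rw [h, logAbs_zero, EReal.toENNReal_bot]; exact zero_le
    · rw [logAbs_of_ne_zero h, EReal.real_coe_toENNReal]
      exact ENNReal.ofReal_le_ofReal hp
  have hneg : ∫⁻ p : ℝ × ℝ, (-(logAbs (p.1 - p.2))).toENNReal ∂(μ.prod μ) ≠ ⊤ := by
    -- Otherwise the energy would be `-∞`.
    intro htop
    rw [logEnergy, eIntegral, htop, EReal.coe_ennreal_top, EReal.sub_top] at hE
    exact absurd hE (by simp)
  have hd : ∀ᵐ p ∂(μ.prod μ), p.1 ≠ p.2 := by
    filter_upwards [ae_lt_top measurable_logAbs_sub.neg.ereal_toENNReal hneg] with p hp h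
    simp [h, logAbs_zero] at hp
  refine ⟨hd, ?_⟩
  have hbound : Integrable (fun p : ℝ × ℝ => -(-(logAbs (p.1 - p.2))).toENNReal.toReal)
      (μ.prod μ) :=
    (integrable_toReal_of_lintegral_ne_top
      measurable_logAbs_sub.neg.ereal_toENNReal.aemeasurable hneg).neg
  refine integrable_of_le_of_le (Measurable.aestronglyMeasurable (by fun_prop))
    (hd.mono fun p hp => ?_) hle hbound hsum
  rw [logAbs_of_ne_zero (sub_ne_zero.2 hp), ← EReal.coe_neg, EReal.real_coe_toENNReal,
    ENNReal.toReal_ofReal', neg_le]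
  exact le_max_left _ _

/-- The mutual energy with `schurMeasure` is an absolutely convergent integral, because the
potential of `schurMeasure` is bounded below and grows at most linearly. -/
lemma integrable_log_prod_schurMeasure [IsProbabilityMeasure μ] (h0 : μ (Iio 0) = 0)
    (hi : Integrable (fun x : ℝ => x) μ) :
    Integrable (fun p : ℝ × ℝ => Real.log |p.1 - p.2|) (μ.prod schurMeasure) := by
  have hm : AEStronglyMeasurable (fun p : ℝ × ℝ => Real.log |p.1 - p.2|)
      (μ.prod schurMeasure) := Measurable.aestronglyMeasurable (by fun_prop)
  have hnn := ae_nonneg_of_Iio_zero h0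
  rw [integrable_prod_iff hm]
  refine ⟨hnn.mono fun x hx => integrable_log_abs_sub_schurMeasure hx, ?_⟩
  refine Integrable.mono'
    (((hi.const_mul 2).add (integrable_const (2 * √(Real.exp 1) + 1 / 2))))
    hm.norm.integral_prod_right' (hnn.mono fun x hx => ?_)
  have i1 := integrable_log_abs_sub_schurMeasure hx
  have i2 : Integrable (fun z => 2 * (x + z)) schurMeasure :=
    ((integrable_const x).add integrable_id_schurMeasure).const_mul 2
  rw [Real.norm_of_nonneg (integral_nonneg fun z => norm_nonneg _)]
  calc ∫ z, ‖Real.log |x - z|‖ ∂schurMeasure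
      ≤ ∫ z, (2 * (x + z) - Real.log |x - z|) ∂schurMeasure := by
        refine integral_mono_ae i1.norm (i2.sub i1) ?_
        filter_upwards [ae_mem_Icc_schurMeasure] with z hz
        have := log_abs_sub_le hx hz.1
        -- `|l| ≤ 2 s - l` whenever `l ≤ s` and `0 ≤ s`.
        rw [Real.norm_eq_abs]
        exact abs_le.2 ⟨by linarith [hz.1], by linarith⟩
    _ = 2 * (x + √(Real.exp 1)) - ∫ z, Real.log |x - z| ∂schurMeasure := by
        rw [integral_sub i2 i1, integral_const_mul, integral_add (integrable_const _)
          integrable_id_schurMeasure, integral_id_schurMeasure]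
        simp
    _ ≤ 2 * x + (2 * √(Real.exp 1) + 1 / 2) := by
        linarith [neg_half_le_schur_potential hx]

lemma integral_log_prod_schurMeasure_le [IsProbabilityMeasure μ] (h0 : μ (Iio 0) = 0)
    (hi : Integrable (fun x : ℝ => x) μ) :
    ∫ p : ℝ × ℝ, Real.log |p.1 - p.2| ∂(μ.prod schurMeasure) ≤
      (∫ x, x ∂μ) / (2 * √(Real.exp 1)) - 1 / 2 := by
  have h := integrable_log_prod_schurMeasure h0 hi
  rw [integral_prod _ h]
  have hi' := (hi.div_const (2 * √(Real.exp 1))).sub (integrable_const (1 / 2 : ℝ))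
  refine (integral_mono_ae h.integral_prod_left hi'
    ((ae_nonneg_of_Iio_zero h0).mono fun x hx => schur_potential_le hx)).trans (le_of_eq ?_)
  simp only [Pi.sub_apply]
  rw [integral_sub (hi.div_const _) (integrable_const _), integral_div]
  simp

lemma integral_log_prod_schurMeasure_self :
    ∫ p : ℝ × ℝ, Real.log |p.1 - p.2| ∂(schurMeasure.prod schurMeasure) = 0 := by
  have hL := sqrt_exp_one_pos
  rw [integral_prod _ (integrable_log_prod_schurMeasure schurMeasure_Iio_zero
    integrable_id_schurMeasure)]
  rw [integral_congr_ae (ae_mem_Icc_schurMeasure.mono fun x hx =>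
      (schur_potential_of_le hx.1 hx.2).2),
    integral_sub (integrable_id_schurMeasure.div_const _) (integrable_const _), integral_div,
    integral_id_schurMeasure]
  simp only [integral_const, probReal_univ, smul_eq_mul, one_mul]
  field_simp
  norm_num

lemma expectation_eq_coe_integral (hi : Integrable (fun x : ℝ => x) μ) :
    expectation μ = ((∫ x, x ∂μ : ℝ) : EReal) :=
  eIntegral_eq_coe_integral (Eventually.of_forall fun _ => rfl) hi

lemma integrable_id_of_expectation_ne_top (h0 : μ (Iio 0) = 0) (h : expectation μ ≠ ⊤) :
    Integrable (fun x : ℝ => x) μ := by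
  have hnn := ae_nonneg_of_Iio_zero h0
  refine (lintegral_ofReal_ne_top_iff_integrable measurable_id'.aestronglyMeasurable hnn).1
    fun htop => h ?_
  have hneg : ∫⁻ x : ℝ, (-(x : EReal)).toENNReal ∂μ = 0 := by
    refine (lintegral_congr_ae (hnn.mono fun x hx => ?_)).trans lintegral_zero
    exact EReal.toENNReal_of_nonpos (by simpa using hx)
  simp only [expectation, eIntegral, EReal.real_coe_toENNReal, htop, hneg]
  simp

lemma logEnergy_schurMeasure : logEnergy schurMeasure = 0 := by
  rw [logEnergy, eIntegral_eq_coe_integral (g := fun p : ℝ × ℝ => Real.log |p.1 - p.2|)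
    ((ae_prod_ne_of_nullSingleton _ _).mono fun p hp => logAbs_of_ne_zero (sub_ne_zero.2 hp))
    (integrable_log_prod_schurMeasure schurMeasure_Iio_zero integrable_id_schurMeasure),
    integral_log_prod_schurMeasure_self, EReal.coe_zero]

lemma potential_schurMeasure {x : ℝ} (hx : 0 ≤ x) :
    potential schurMeasure x = ((∫ z, Real.log |x - z| ∂schurMeasure : ℝ) : EReal) := by
  refine eIntegral_eq_coe_integral ?_ (integrable_log_abs_sub_schurMeasure hx)
  have : ∀ᵐ z ∂schurMeasure, z ∉ ({x} : Set ℝ) :=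
    measure_eq_zero_iff_ae_notMem.1 (measure_singleton x)
  exact this.mono fun z hz => logAbs_of_ne_zero (sub_ne_zero.2 fun h => hz h.symm)

lemma expectation_schurMeasure : expectation schurMeasure = ((√(Real.exp 1) : ℝ) : EReal) := by
  rw [expectation_eq_coe_integral integrable_id_schurMeasure, integral_id_schurMeasure]

lemma isFeasible_schurMeasure : IsFeasible ∅ schurMeasure where
  isProbabilityMeasure := inferInstance
  nonneg_support := schurMeasure_Iio_zero
  energy_nonneg := logEnergy_schurMeasure.ge
  log_nonneg := by simp

/-- The sandwich `0 ≤ I(μ) ≤ 2 ∫ U dμ ≤ m / √e - 1` for the potential `U` of `schurMeasure` and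
the mean `m` of `μ`, with `I(μ) = 2 ∫ U dμ` only for `μ = schurMeasure`. -/
theorem sqrt_exp_one_le_integral (hμ : IsFeasible ∅ μ) (hi : Integrable (fun x : ℝ => x) μ) :
    √(Real.exp 1) ≤ ∫ x, x ∂μ ∧ (∫ x, x ∂μ = √(Real.exp 1) → μ = schurMeasure) := by
  have hL := sqrt_exp_one_pos
  have := hμ.isProbabilityMeasure
  have h0 := hμ.nonneg_support
  obtain ⟨hd, iμ⟩ := integrable_log_of_logEnergy_nonneg h0 hi hμ.energy_nonneg
  have hE : 0 ≤ ∫ p : ℝ × ℝ, Real.log |p.1 - p.2| ∂(μ.prod μ) := by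
    have h := hμ.energy_nonneg
    rw [logEnergy, eIntegral_eq_coe_integral (g := fun p : ℝ × ℝ => Real.log |p.1 - p.2|)
      (hd.mono fun p hp => logAbs_of_ne_zero (sub_ne_zero.2 hp)) iμ] at h
    exact_mod_cast h
  have hJ := integral_log_prod_schurMeasure_le h0 hi
  obtain ⟨hle, heq⟩ := LogEnergy.energy_sub h0 schurMeasure_Iio_zero hd
    (ae_prod_ne_of_nullSingleton μ schurMeasure)
    (ae_prod_ne_of_nullSingleton schurMeasure schurMeasure) iμ
    (integrable_log_prod_schurMeasure h0 hi)
    (integrable_log_prod_schurMeasure schurMeasure_Iio_zero integrable_id_schurMeasure)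
  rw [integral_log_prod_schurMeasure_self] at hle heq
  constructor
  · have h1 : 1 / 2 ≤ (∫ x, x ∂μ) / (2 * √(Real.exp 1)) := by linarith
    rw [le_div_iff₀ (by positivity)] at h1
    linarith
  · intro hm
    have h1 : √(Real.exp 1) / (2 * √(Real.exp 1)) = 1 / 2 := by field_simp
    rw [hm, h1] at hJ
    exact heq (by linarith)

lemma lambdaInf_empty : lambdaInf ∅ = ((√(Real.exp 1) : ℝ) : EReal) := by
  refine le_antisymm (sInf_le ⟨schurMeasure, isFeasible_schurMeasure,
    expectation_schurMeasure.symm⟩) (le_sInf ?_)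
  rintro t ⟨μ, hμ, rfl⟩
  by_cases h : expectation μ = ⊤
  · rw [h]; exact le_top
  · have hi := integrable_id_of_expectation_ne_top hμ.nonneg_support h
    rw [expectation_eq_coe_integral hi]
    exact EReal.coe_le_coe_iff.2 (sqrt_exp_one_le_integral hμ hi).1

lemma isMinimizer_empty_iff : IsMinimizer ∅ μ ↔ μ = schurMeasure := by
  constructor
  · rintro ⟨hμ, he⟩
    rw [lambdaInf_empty] at he
    have hi := integrable_id_of_expectation_ne_top hμ.nonneg_support (he ▸ EReal.coe_ne_top _)
    rw [expectation_eq_coe_integral hi] at he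
    exact (sqrt_exp_one_le_integral hμ hi).2 (EReal.coe_injective he)
  · rintro rfl
    exact ⟨isFeasible_schurMeasure, expectation_schurMeasure.trans lambdaInf_empty.symm⟩

lemma isOptimalMeasure_schurMeasure : IsOptimalMeasure ∅ schurMeasure := by
  have hL := sqrt_exp_one_pos
  have h18 : 4 * √(Real.exp 1) ≤ 18 := by
    have h1 : √(Real.exp 1) ≤ 2 :=
      (Real.sqrt_le_left zero_le_two).2 (by linarith [Real.exp_one_lt_d9])
    linarith
  have hsum : ∀ x : ℝ, 0 ≤ x → lambdaInf ∅ + ∑ Q ∈ (∅ : Finset (Polynomial ℝ)),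
      (((0 : Polynomial ℝ → ℝ) Q : ℝ) : EReal) * logAbs (Q.eval x) +
        ((2 * √(Real.exp 1) : ℝ) : EReal) * potential schurMeasure x =
      ((√(Real.exp 1) + 2 * √(Real.exp 1) * ∫ z, Real.log |x - z| ∂schurMeasure : ℝ) : EReal) := by
    intro x hx
    rw [Finset.sum_empty, add_zero, lambdaInf_empty, potential_schurMeasure hx, EReal.coe_add,
      EReal.coe_mul (2 * √(Real.exp 1))]
  have haffine : ∀ x : ℝ, √(Real.exp 1) + 2 * √(Real.exp 1) * (x / (2 * √(Real.exp 1)) - 1 / 2) =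
      x := by
    intro x; field_simp; ring
  refine ⟨inferInstance, expectation_schurMeasure.trans lambdaInf_empty.symm,
    logEnergy_schurMeasure, 0, fun _ => 0, fun _ => 4 * √(Real.exp 1), Icc 0 (4 * √(Real.exp 1)),
    fun _ => by positivity, (iUnion_const _).symm, Icc_subset_Icc_right h18,
    schurMeasure_compl_Icc, 0, 2 * √(Real.exp 1), by simp, by positivity, ?_, ?_, by simp⟩
  · intro x hx
    rw [hsum x hx]
    refine EReal.coe_le_coe_iff.2 ?_
    have := mul_le_mul_of_nonneg_left (schur_potential_le hx) (by positivity :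
      0 ≤ 2 * √(Real.exp 1))
    linarith [haffine x]
  · intro x hx
    rw [hsum x hx.1, (schur_potential_of_le hx.1 hx.2).2, haffine x]

lemma IsOptimalMeasure.isMinimizer_empty (h : IsOptimalMeasure ∅ μ) : IsMinimizer ∅ μ := by
  obtain ⟨hp, he, hE, l, a, b, S, -, -, hS, hμS, -⟩ := h
  refine ⟨⟨hp, measure_mono_null ?_ hμS, hE.ge, by simp⟩, he⟩
  intro x (hx : x < 0) hxS
  exact not_lt.2 (hS hxS).1 hx

end TraceProblem

theorem corollary1p3 :
    TraceProblem.lambdaInf ∅ = ((√(Real.exp 1) : ℝ) : EReal) ∧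
    (∀ μ : MeasureTheory.Measure ℝ,
      TraceProblem.IsMinimizer ∅ μ ↔ μ = TraceProblem.schurMeasure) ∧
    (∀ μ : MeasureTheory.Measure ℝ,
      TraceProblem.IsOptimalMeasure ∅ μ ↔ μ = TraceProblem.schurMeasure) := by
  refine ⟨TraceProblem.lambdaInf_empty, fun μ => TraceProblem.isMinimizer_empty_iff, fun μ =>
    ⟨fun h => TraceProblem.isMinimizer_empty_iff.1 h.isMinimizer_empty, ?_⟩⟩
  rintro rfl
  exact TraceProblem.isOptimalMeasure_schurMeasure
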